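/- Let $M_n$ (the Motzkin number) be the number of lattice paths from $(0,0)$ to $(n,0)$ with steps $(1,1)$, $(1,0)$, $(1,-1)$ that never go below the $x$-axis, and let $T_n$ (the central trinomial coefficient) be the number of such paths without the restriction of staying on or above the $x$-axis. Let $p$ be a prime. The density of a value $x\in\mathbb F_p$ in a sequence $(u_n)_{n\ge 0}$ over $\mathbb F_p$ is $\lim_{N\to\infty}\frac1N\left|\{0\le n<N : u_n=x\}\right|$. All congruences are modulo $p$, and $n,m$ range over non-negative integers. 1. If $p\mid T_n$ for some $n<p$, then the density of $0$ in $M_n \bmod p$ exists and equals $1$. 2. If $p>2$ and $p\nmid T_n$ for all $n<p$, then the density of $0$ in $M_n\bmod p$ exists and equals $$\frac{\left|\{n<p-2 : M_n\equiv 0\}\right|}{p}+\frac{2\left|\{m<p-1 : T_m\equiv T_{p-1}T_{m+1}\}\right|}{(p-1)(p+1)}+\frac{2\left|\{m<p-1 : T_m\equiv T_{m+1}\}\right|}{(p-1)p(p+1)}.$$ Write $D_0$ for the density of $0$ in $M_n \bmod p$ whenever it exists (in particular for all $p>2$, by 1 and 2). 3. Suppose that the following conjecture holds for $p$: if $p\nmid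 T_n$ for all $n<p$, then the residues of $T_0,\dots,T_{p-1}$ generate the multiplicative group $\mathbb F_p^\times$. Then every nonzero $x\in\mathbb F_p$ has density $\frac{1-D_0}{p-1}$ in $M_n\bmod p$. 4. If $p>2$, then $D_0\ge\frac{2}{p(p-1)}$. -/

import Mathlib

open Filter Topology

/-- A lattice path from the origin with `n` steps UP `(1, 1)`, LEVEL `(1, 0)`, DOWN `(1, -1)`,
encoded by the sequence of its vertical increments. -/
def latticePaths (n : ℕ) : Finset (Fin n → ℤ) :=
  Fintype.piFinset fun _ => {-1, 0, 1}

/-- The central trinomial coefficient `T_n`: the number of lattice paths from `(0, 0)` to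
`(n, 0)`. -/
def centralTrinomial (n : ℕ) : ℕ :=
  ((latticePaths n).filter fun s => ∑ i, s i = 0).card

/-- The Motzkin number `M_n`: the number of lattice paths from `(0, 0)` to `(n, 0)` that never go
below the horizontal axis (the height after each step is nonnegative). -/
def motzkin (n : ℕ) : ℕ :=
  ((latticePaths n).filter fun s =>
    ∑ i, s i = 0 ∧ ∀ j : Fin n, 0 ≤ ∑ i ∈ Finset.Iic j, s i).card

/-- `S ⊆ ℕ` has asymptotic density `d` (the limit exists and equals `d`). -/
def HasAsympDensity (S : Set ℕ) (d : ℝ) : Prop :=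
  Tendsto (fun N : ℕ => ((S ∩ Set.Iio N).ncard : ℝ) / (N : ℝ)) atTop (𝓝 d)

/-- The value `x` has density `d` in the sequence `u` over `ZMod p`. -/
def ValueHasDensity {p : ℕ} (u : ℕ → ZMod p) (x : ZMod p) (d : ℝ) : Prop :=
  HasAsympDensity {n | u n = x} d

/-- The conjecture, at the prime `p`, on central trinomial coefficients: if `p` divides none of
`T_0, …, T_{p-1}`, then their residues generate the multiplicative group of `ZMod p`. -/
def TrinomialGenerationConjectureAt (p : ℕ) : Prop :=
  (∀ n < p, ¬ p ∣ centralTrinomial n) →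
    Subgroup.closure {g : (ZMod p)ˣ | ∃ n < p, (g : ZMod p) = (centralTrinomial n : ZMod p)} = ⊤

/-- The explicit expression for the density of `0`, used for primes `p > 2`. -/
noncomputable def motzkinZeroDensity (p : ℕ) : ℝ :=
  (({n ∈ Finset.range (p - 2) | (motzkin n : ZMod p) = 0} : Finset ℕ).card : ℝ) / (p : ℝ)
  + 2 * (({m ∈ Finset.range (p - 1) | (centralTrinomial m : ZMod p)
        = (centralTrinomial (p - 1) : ZMod p) * (centralTrinomial (m + 1) : ZMod p)} :
          Finset ℕ).card : ℝ) / (((p : ℝ) - 1) * ((p : ℝ) + 1))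
  + 2 * (({m ∈ Finset.range (p - 1) | (centralTrinomial m : ZMod p)
        = (centralTrinomial (m + 1) : ZMod p)} : Finset ℕ).card : ℝ)
      / (((p : ℝ) - 1) * (p : ℝ) * ((p : ℝ) + 1))

/-! Put P = x + 1 + x⁻¹, so that T_n = [x^0] P^n and M_n = [x^0] P^n - [x^2] P^n. Frobenius gives
P^(p^i) = x^(p^i) + 1 + x^(-p^i) mod p, hence the Lucas congruences T_(p^i n + s) = T_n T_s for s <
p^i, and M_(p^i n + s) = T_n M_s for s + 2 < p^i (`centralTrinomial_lucas`, `motzkin_lucas`).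
Cutting the base-p digits into high (N), middle (t) and low (s) blocks gives M = T_N T_t M_s, up to
a negligible set of s.

If T_m = 0 for some digit m, almost every t contains that digit, so 0 has density 1. Otherwise no
T_n vanishes, and zeros are sorted by their last digit. Below p-2 the digit alone decides; for the
two top digits the condition is T_(t+1) = c T_t with c = e or -3e, where e = T_(p-1). Counts of such
ratios satisfy a recursion in the power of p, closed because e^2 = 1 (`ratioCount_pow_succ`). The
reflection T_(p-1-n) (-3)^n = e T_n gives e^2 = 1 and merges the counts into the two in the formula.

For nonzero values, a character sum over T_t, t < p^j, is the j-th power of the sum over one digit.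
The conjecture makes the latter smaller than p in norm for nontrivial characters, so T_t
equidistributes on the units and spreads each nonzero M_s evenly. -/

open LaurentPolynomial in
/-- The coefficient of `x ^ k` in `(x + 1 + x⁻¹) ^ n` over the ring `R`. -/
noncomputable def trinomialCoeff (R : Type*) [CommRing R] (n : ℕ) (k : ℤ) : R :=
  ((T 1 + T 0 + T (-1) : R[T;T⁻¹]) ^ n).coeff k

open LaurentPolynomial in
theorem LaurentPolynomial.coeff_mul_T {R : Type*} [Semiring R] (f : R[T;T⁻¹]) (a k : ℤ) :
    (f * T a).coeff k = f.coeff (k - a) := by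
  rw [T, AddMonoidAlgebra.coeff_mul_single_apply, mul_one, sub_eq_add_neg]

/-! ### Trinomial coefficients and their behaviour under Frobenius -/

namespace trinomialCoeff

variable {R : Type*} [CommRing R]

theorem zero_left (k : ℤ) : trinomialCoeff R 0 k = if k = 0 then 1 else 0 := by
  rw [trinomialCoeff, pow_zero, ← LaurentPolynomial.T_zero, LaurentPolynomial.T_apply]
  simp only [eq_comm]

theorem succ (n : ℕ) (k : ℤ) : trinomialCoeff R (n + 1) k =
    trinomialCoeff R n (k - 1) + trinomialCoeff R n k + trinomialCoeff R n (k + 1) := by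
  simp only [trinomialCoeff, pow_succ, mul_add, AddMonoidAlgebra.coeff_add, Finsupp.add_apply,
    LaurentPolynomial.coeff_mul_T, sub_zero, sub_neg_eq_add]

theorem neg (n : ℕ) (k : ℤ) : trinomialCoeff R n (-k) = trinomialCoeff R n k := by
  induction n generalizing k with
  | zero => simp [zero_left]
  | succ n ih =>
    rw [succ, succ, ← ih (k - 1), ← ih k, ← ih (k + 1), neg_sub, neg_add',
      show -k + 1 = 1 - k by ring]
    ring

theorem eq_zero_of_lt_abs {n : ℕ} {k : ℤ} (h : (n : ℤ) < |k|) : trinomialCoeff R n k = 0 := by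
  induction n generalizing k with
  | zero => rw [zero_left, if_neg]; rintro rfl; simp at h
  | succ n ih =>
    rw [succ, ih, ih, ih] <;> grind

/-- The coefficient form of `x d/dx P ^ (n + 1) = (n + 1) P ^ n (x - x⁻¹)`. -/
theorem mul_succ (n : ℕ) (k : ℤ) : (k : R) * trinomialCoeff R (n + 1) k =
    (n + 1) * (trinomialCoeff R n (k - 1) - trinomialCoeff R n (k + 1)) := by
  induction n generalizing k with
  | zero =>
    simp only [succ, zero_left]
    by_cases h0 : k = 0
    · simp [h0]
    by_cases h1 : k = 1
    · simp [h1]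
    by_cases h2 : k = -1
    · simp [h2]
    rw [if_neg (by omega), if_neg h0, if_neg (by omega)]
    simp
  | succ n ih =>
    have h₁ := ih (k - 1)
    have h₂ := ih k
    have h₃ := ih (k + 1)
    rw [succ (n + 1)]
    have e₁ := succ (R := R) n (k - 1)
    have e₂ := succ (R := R) n (k + 1)
    push_cast at h₁ h₂ h₃ ⊢
    rw [sub_add_cancel] at *
    rw [add_sub_cancel_right] at *
    linear_combination h₁ + h₂ + h₃ - (n + 1) * e₁ + (n + 1) * e₂

/-- Frobenius: P^(p^i) is again a sum of three monomials, with exponents scaled by p^i. -/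
theorem add_prime_pow {p : ℕ} [Fact p.Prime] [CharP R p] (i a : ℕ) (k : ℤ) :
    trinomialCoeff R (a + p ^ i) k = trinomialCoeff R a (k - (p ^ i : ℕ)) +
      trinomialCoeff R a k + trinomialCoeff R a (k + (p ^ i : ℕ)) := by
  have : CharP (LaurentPolynomial R) p := charP_of_injective_algebraMap (R := R)
    (fun a b h => by simpa using congrArg (fun f => f.coeff 0) h) p
  rw [trinomialCoeff, pow_add, add_pow_char_pow, add_pow_char_pow]
  simp only [trinomialCoeff, LaurentPolynomial.T_pow, mul_add, AddMonoidAlgebra.coeff_add,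
    Finsupp.add_apply, LaurentPolynomial.coeff_mul_T]
  simp

/-- Both sides obey the same three-term recursion in n. At n = 0 with j ≠ 0, the bound on s + |l|
pushes the index outside the support of P^s. -/
theorem add_prime_pow_mul {p : ℕ} [Fact p.Prime] [CharP R p] (i n : ℕ) {s : ℕ} {l : ℤ}
    (h : s + |l| < (p ^ i : ℕ)) (j : ℤ) :
    trinomialCoeff R (s + p ^ i * n) ((p ^ i : ℕ) * j + l) =
      trinomialCoeff R n j * trinomialCoeff R s l := by
  induction n generalizing j with
  | zero =>
    rw [zero_left, mul_zero, add_zero]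
    split_ifs with hj
    · simp [hj]
    · rw [zero_mul, eq_zero_of_lt_abs]
      have : (p ^ i : ℕ) * (1:ℤ) ≤ (p ^ i : ℕ) * |j| := by
        gcongr
        exact Int.one_le_abs hj
      rw [← Nat.abs_cast (p ^ i), ← abs_mul] at this
      have h2 := abs_sub_abs_le_abs_sub (((p ^ i : ℕ) : ℤ) * j) (-l)
      rw [abs_neg, sub_neg_eq_add] at h2
      simp only [Nat.abs_cast] at *
      linarith
  | succ n ih =>
    rw [mul_add, mul_one, ← add_assoc, add_prime_pow, succ, add_mul, add_mul, ← ih, ← ih, ← ih]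
    rw [show ((p ^ i : ℕ) : ℤ) * j + l - (p ^ i : ℕ) = (p ^ i : ℕ) * (j - 1) + l by ring,
      show ((p ^ i : ℕ) : ℤ) * j + l + (p ^ i : ℕ) = (p ^ i : ℕ) * (j + 1) + l by ring]

end trinomialCoeff

/-! ### Lattice paths, Motzkin numbers and Lucas congruences -/

section

variable {R : Type*} [CommRing R]

theorem cast_card_latticePaths_sum_eq (n : ℕ) (k : ℤ) :
    ((((latticePaths n).filter fun s => ∑ i, s i = k).card : ℕ) : R) = trinomialCoeff R n k := by
  have h : ((LaurentPolynomial.T 1 + LaurentPolynomial.T 0 + LaurentPolynomial.T (-1) :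
      LaurentPolynomial R)) ^ n = ∑ s ∈ latticePaths n, LaurentPolynomial.T (∑ i, s i) := by
    have h1 := Finset.prod_univ_sum (fun _ : Fin n => ({-1, 0, 1} : Finset ℤ))
      (fun _ a => (LaurentPolynomial.T a : LaurentPolynomial R))
    have h2 : ∀ s : Fin n → ℤ, ∏ i, (LaurentPolynomial.T (s i) : LaurentPolynomial R) =
        LaurentPolynomial.T (∑ i, s i) := by
      intro s
      have := map_prod (AddMonoidAlgebra.of R ℤ) (fun i => Multiplicative.ofAdd (s i)) Finset.univ
      rw [← ofAdd_sum] at this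
      exact this.symm
    simp only [h2] at h1
    rw [latticePaths, ← h1, Finset.prod_const, Finset.card_univ, Fintype.card_fin]
    congr 1
    rw [Finset.sum_insert (by decide), Finset.sum_insert (by decide), Finset.sum_singleton]
    ring
  rw [trinomialCoeff, h, AddMonoidAlgebra.coeff_sum, Finset.sum_apply']
  simp only [LaurentPolynomial.T_apply, Finset.sum_boole]

theorem cast_centralTrinomial (n : ℕ) : (centralTrinomial n : R) = trinomialCoeff R n 0 :=
  cast_card_latticePaths_sum_eq n 0

/-- The lattice paths that never go below the horizontal axis and end at height `h`. -/
def nonnegPaths (n : ℕ) (h : ℤ) : Finset (Fin n → ℤ) :=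
  (latticePaths n).filter fun s => ∑ i, s i = h ∧ ∀ j : Fin n, 0 ≤ ∑ i ∈ Finset.Iic j, s i

theorem nonnegPaths_eq_empty {n : ℕ} {h : ℤ} (hh : h < 0) : nonnegPaths n h = ∅ := by
  rw [nonnegPaths, Finset.filter_eq_empty_iff]
  rintro s - ⟨rfl, hs⟩
  cases n with
  | zero => simp at hh
  | succ n =>
    have := hs (Fin.last n)
    rw [show Finset.Iic (Fin.last n) = Finset.univ from Finset.Iic_top] at this
    omega

theorem sum_Iic_castSucc {n : ℕ} (s : Fin (n + 1) → ℤ) (j : Fin n) :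
    ∑ i ∈ Finset.Iic j.castSucc, s i = ∑ i ∈ Finset.Iic j, s i.castSucc := by
  rw [← Fin.map_castSuccEmb_Iic, Finset.sum_map]
  rfl

theorem snoc_mem_nonnegPaths {n : ℕ} {h a : ℤ} (hh : 0 ≤ h) {s : Fin n → ℤ} :
    (Fin.snoc s a : Fin (n + 1) → ℤ) ∈ nonnegPaths (n + 1) h ↔
      a ∈ ({-1, 0, 1} : Finset ℤ) ∧ s ∈ nonnegPaths n (h - a) := by
  have hl : Finset.Iic (Fin.last n) = Finset.univ := Finset.Iic_top
  simp only [nonnegPaths, latticePaths, Finset.mem_filter, Fintype.mem_piFinset,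
    Fin.forall_fin_succ', sum_Iic_castSucc, hl, Fin.sum_univ_castSucc, Fin.snoc_castSucc,
    Fin.snoc_last, eq_sub_iff_add_eq]
  grind

theorem card_nonnegPaths_succ (n : ℕ) {h : ℤ} (hh : 0 ≤ h) :
    (nonnegPaths (n + 1) h).card =
      (nonnegPaths n (h - 1)).card + (nonnegPaths n h).card + (nonnegPaths n (h + 1)).card := by
  have key : (nonnegPaths (n + 1) h).card =
      ∑ a ∈ ({-1, 0, 1} : Finset ℤ), (nonnegPaths n (h - a)).card := by
    rw [← Finset.card_sigma]
    refine Finset.card_bij' (fun s _ => ⟨s (Fin.last n), Fin.init s⟩)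
      (fun x _ => (Fin.snoc x.2 x.1 : Fin (n + 1) → ℤ)) ?_ ?_ ?_ ?_
    · intro s hs
      rw [← Fin.snoc_init_self s, snoc_mem_nonnegPaths hh] at hs
      simpa using hs
    · rintro ⟨a, s⟩ hx
      rw [snoc_mem_nonnegPaths hh]
      simpa using hx
    · intro s _
      simp
    · rintro ⟨a, s⟩ _
      simp
  rw [key, Finset.sum_insert (by decide), Finset.sum_insert (by decide), Finset.sum_singleton,
    sub_neg_eq_add, sub_zero]
  ring

/-- The reflection principle, obtained from the common recursion instead of a bijection. Height -1
is included as the boundary value: both sides vanish there, the right one by the symmetry k ↦ -k. -/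
theorem cast_card_nonnegPaths (n : ℕ) {h : ℤ} (hh : -1 ≤ h) :
    ((nonnegPaths n h).card : R) = trinomialCoeff R n h - trinomialCoeff R n (h + 2) := by
  have hneg (n : ℕ) : ((nonnegPaths n (-1)).card : R) =
      trinomialCoeff R n (-1) - trinomialCoeff R n (-1 + 2) := by
    rw [nonnegPaths_eq_empty (by norm_num), trinomialCoeff.neg]
    norm_num
  induction n generalizing h with
  | zero =>
    rcases hh.eq_or_lt with rfl | hh
    · exact hneg 0
    rw [trinomialCoeff.zero_left, trinomialCoeff.zero_left, if_neg (by omega : ¬ h + 2 = 0)]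
    by_cases h0 : h = 0
    · subst h0
      simp [nonnegPaths, latticePaths]
    · simp [nonnegPaths, h0, Ne.symm h0]
  | succ n ih =>
    rcases hh.eq_or_lt with rfl | hh
    · exact hneg (n + 1)
    rw [card_nonnegPaths_succ n (by omega)]
    push_cast
    rw [ih (by omega), ih (by omega), ih (by omega), trinomialCoeff.succ,
      trinomialCoeff.succ, show h - 1 + 2 = h + 2 - 1 by ring, show h + 1 + 2 = h + 2 + 1 by ring]
    ring

theorem cast_motzkin (n : ℕ) :
    (motzkin n : R) = trinomialCoeff R n 0 - trinomialCoeff R n 2 := by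
  exact cast_card_nonnegPaths n (h := 0) (by norm_num)

theorem trinomialCoeff_succ_zero (n : ℕ) : trinomialCoeff R (n + 1) 0 =
    trinomialCoeff R n 0 + 2 * trinomialCoeff R n 1 := by
  rw [trinomialCoeff.succ, zero_sub, trinomialCoeff.neg, zero_add]
  ring

theorem trinomialCoeff_succ_one (n : ℕ) : trinomialCoeff R (n + 1) 1 =
    trinomialCoeff R n 0 + trinomialCoeff R n 1 + trinomialCoeff R n 2 := by
  rw [trinomialCoeff.succ]
  norm_num

/-- Eliminating the coefficients of x and x^2 expresses M through T alone, which still obeys a Lucas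
congruence where adding 2 to the index carries. -/
theorem two_mul_motzkin (n : ℕ) : 2 * (motzkin n : R) =
    3 * centralTrinomial n + 2 * centralTrinomial (n + 1) - centralTrinomial (n + 2) := by
  simp only [cast_motzkin, cast_centralTrinomial, trinomialCoeff_succ_zero,
    trinomialCoeff_succ_one]
  ring

theorem centralTrinomial_recurrence (n : ℕ) : (n + 2) * (centralTrinomial (n + 2) : R) =
    (2 * n + 3) * centralTrinomial (n + 1) + 3 * (n + 1) * centralTrinomial n := by
  have h := trinomialCoeff.mul_succ (R := R) n 1
  norm_num at h
  rw [trinomialCoeff_succ_one] at h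
  simp only [cast_centralTrinomial, trinomialCoeff_succ_zero, trinomialCoeff_succ_one]
  linear_combination 2 * h

theorem centralTrinomial_zero : centralTrinomial 0 = 1 := by
  have := cast_centralTrinomial (R := ℤ) 0
  rw [trinomialCoeff.zero_left] at this
  exact_mod_cast this

theorem centralTrinomial_one : centralTrinomial 1 = 1 := by
  have := cast_centralTrinomial (R := ℤ) 1
  rw [trinomialCoeff_succ_zero, trinomialCoeff.zero_left, trinomialCoeff.zero_left] at this
  norm_num at this
  exact this

theorem centralTrinomial_two : centralTrinomial 2 = 3 := by
  have := centralTrinomial_recurrence (R := ℤ) 0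
  norm_num [centralTrinomial_zero, centralTrinomial_one] at this
  omega

variable {p : ℕ} [Fact p.Prime] [CharP R p]

theorem centralTrinomial_lucas (i n : ℕ) {s : ℕ} (hs : s < p ^ i) :
    (centralTrinomial (p ^ i * n + s) : R) = centralTrinomial n * centralTrinomial s := by
  have := trinomialCoeff.add_prime_pow_mul (R := R) (p := p) i n (s := s) (l := 0)
    (by simpa using mod_cast hs) 0
  simp only [cast_centralTrinomial, ← this]
  rw [add_comm]
  simp

theorem motzkin_lucas (i n : ℕ) {s : ℕ} (hs : s + 2 < p ^ i) :
    (motzkin (p ^ i * n + s) : R) = centralTrinomial n * motzkin s := by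
  have h0 := trinomialCoeff.add_prime_pow_mul (R := R) (p := p) i n (s := s) (l := 0)
    (by rw [abs_zero]; exact_mod_cast (by omega : s + 0 < p ^ i)) 0
  have h2 := trinomialCoeff.add_prime_pow_mul (R := R) (p := p) i n (s := s) (l := 2)
    (by rw [abs_two]; exact_mod_cast hs) 0
  simp only [cast_centralTrinomial, cast_motzkin, mul_sub, ← h0, ← h2]
  rw [add_comm]
  simp

end

/-! ### Reflection modulo p and the two top digits -/

section

variable {p : ℕ} [hp : Fact p.Prime]

/-- Modulo p one has a = -(n+1), and the three-term recurrence read backwards becomes the forward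
one up to powers of -3. Its leading coefficient is invertible in the range used. -/
theorem centralTrinomial_reflection {a n : ℕ} (h : a + n + 1 = p) :
    (centralTrinomial a : ZMod p) * (-3) ^ n = centralTrinomial (p - 1) * centralTrinomial n := by
  induction n using Nat.strong_induction_on generalizing a with
  | _ n ih =>
    match n, ih, h with
    | 0, _, h =>
      rw [show p - 1 = a by omega, centralTrinomial_zero]
      simp
    | 1, _, h =>
      have hr := centralTrinomial_recurrence (R := ZMod p) a
      have hc : (a : ZMod p) = -2 := by
        have : ((a + 1 + 1 : ℕ) : ZMod p) = 0 := by rw [h, ZMod.natCast_self]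
        push_cast at this
        linear_combination this
      rw [show p - 1 = a + 1 by omega, centralTrinomial_one]
      push_cast
      rw [hc] at hr
      linear_combination -hr
    | n + 2, ih, h =>
      have hr := centralTrinomial_recurrence (R := ZMod p) a
      have hr' := centralTrinomial_recurrence (R := ZMod p) n
      have h1 := ih (n + 1) (by omega) (a := a + 1) (by omega)
      have h2 := ih n (by omega) (a := a + 2) (by omega)
      have hc : (a : ZMod p) = -(n + 3) := by
        have : ((a + (n + 2) + 1 : ℕ) : ZMod p) = 0 := by rw [h, ZMod.natCast_self]
        push_cast at this
        linear_combination this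
      have hn : ((n : ZMod p) + 2) ≠ 0 := by
        intro h0
        have : ((n + 2 : ℕ) : ZMod p) = 0 := by push_cast; exact h0
        rw [ZMod.natCast_eq_zero_iff] at this
        exact absurd (Nat.le_of_dvd (by omega) this) (by omega)
      rw [hc] at hr
      apply mul_left_cancel₀ hn
      linear_combination (2 * n + 3) * h1 + 3 * (n + 1) * h2 - (-3) ^ (n + 1) * hr -
        centralTrinomial (p - 1) * hr'

theorem three_mul_centralTrinomial_sub_two {a : ℕ} (h : a + 2 = p) :
    3 * (centralTrinomial a : ZMod p) = -centralTrinomial (p - 1) := by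
  have := centralTrinomial_reflection (p := p) (a := a) (n := 1) (by omega)
  rw [centralTrinomial_one] at this
  push_cast at this
  linear_combination -this

theorem neg_three_ne_zero (h3 : p ≠ 3) : (-3 : ZMod p) ≠ 0 := by
  rw [neg_ne_zero]
  intro h
  have : ((3 : ℕ) : ZMod p) = 0 := by exact_mod_cast h
  rw [ZMod.natCast_eq_zero_iff, Nat.prime_dvd_prime_iff_eq hp.out Nat.prime_three] at this
  exact h3 this

theorem centralTrinomial_sub_one_mul_self (h3 : p ≠ 3) :
    (centralTrinomial (p - 1) : ZMod p) * centralTrinomial (p - 1) = 1 := by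
  have := centralTrinomial_reflection (p := p) (a := 0) (n := p - 1)
    (by have := hp.out.pos; omega)
  rw [← this, ZMod.pow_card_sub_one_eq_one (neg_three_ne_zero h3), centralTrinomial_zero]
  simp

theorem centralTrinomial_mul_add (n : ℕ) {s : ℕ} (hs : s < p) :
    (centralTrinomial (p * n + s) : ZMod p) = centralTrinomial n * centralTrinomial s := by
  simpa using centralTrinomial_lucas (R := ZMod p) (p := p) 1 n (s := s) (by simpa using hs)

theorem motzkin_mul_add (n : ℕ) {s : ℕ} (hs : s + 2 < p) :
    (motzkin (p * n + s) : ZMod p) = centralTrinomial n * motzkin s := by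
  simpa using motzkin_lucas (R := ZMod p) (p := p) 1 n (s := s) (by simpa using hs)

theorem centralTrinomial_mul_prime (n : ℕ) :
    (centralTrinomial (p * n) : ZMod p) = centralTrinomial n := by
  simpa [centralTrinomial_zero] using centralTrinomial_mul_add (p := p) n hp.out.pos

theorem two_mul_motzkin_mul_add_sub_two (n : ℕ) {a : ℕ} (h : a + 2 = p) :
    2 * (motzkin (p * n + a) : ZMod p) =
      centralTrinomial (p - 1) * centralTrinomial n - centralTrinomial (n + 1) := by
  rw [two_mul_motzkin, centralTrinomial_mul_add n (by omega : a < p), add_assoc (p * n),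
    centralTrinomial_mul_add n (by omega : a + 1 < p), add_assoc (p * n), h, ← mul_add_one,
    centralTrinomial_mul_prime, show p - 1 = a + 1 by omega]
  have := three_mul_centralTrinomial_sub_two h
  rw [show p - 1 = a + 1 by omega] at this
  linear_combination (centralTrinomial n : ZMod p) * this

theorem two_mul_motzkin_mul_add_sub_one (n : ℕ) :
    2 * (motzkin (p * n + (p - 1)) : ZMod p) =
      3 * centralTrinomial (p - 1) * centralTrinomial n + centralTrinomial (n + 1) := by
  have h1 := hp.out.one_lt
  rw [two_mul_motzkin, centralTrinomial_mul_add n (by omega : p - 1 < p),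
    show p * n + (p - 1) + 1 = p * (n + 1) by rw [mul_add_one]; omega,
    show p * n + (p - 1) + 2 = p * (n + 1) + 1 by rw [mul_add_one]; omega,
    centralTrinomial_mul_prime, centralTrinomial_mul_add (n + 1) h1, centralTrinomial_one]
  push_cast
  ring

theorem centralTrinomial_ne_zero (hT : ∀ n < p, ¬ p ∣ centralTrinomial n) (n : ℕ) :
    (centralTrinomial n : ZMod p) ≠ 0 := by
  induction n using Nat.strong_induction_on with
  | _ n ih =>
    rcases lt_or_ge n p with h | h
    · rw [Ne, ZMod.natCast_eq_zero_iff]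
      exact hT n h
    · rw [← Nat.div_add_mod n p, centralTrinomial_mul_add _ (Nat.mod_lt n hp.out.pos)]
      refine mul_ne_zero (ih _ (Nat.div_lt_self (by have := hp.out.pos; omega) hp.out.one_lt))
        (ih _ ((Nat.mod_lt n hp.out.pos).trans_le h))

theorem ne_three_of_not_dvd_centralTrinomial (hT : ∀ n < p, ¬ p ∣ centralTrinomial n) :
    p ≠ 3 := by
  rintro rfl
  exact hT 2 (by norm_num) (by rw [centralTrinomial_two])

end

/-! ### Counting in blocks and asymptotic density -/

theorem Nat.count_mul_eq_sum (P : ℕ → Prop) [DecidablePred P] (a b : ℕ) :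
    Nat.count P (a * b) = ∑ t ∈ Finset.range b, Nat.count (fun s => P (a * t + s)) a := by
  induction b with
  | zero => simp
  | succ b ih => rw [mul_add_one, Nat.count_add, ih, Finset.sum_range_succ]

theorem Nat.count_eq_sum_ite (P : ℕ → Prop) [DecidablePred P] (a : ℕ) :
    Nat.count P a = ∑ s ∈ Finset.range a, if P s then 1 else 0 := by
  rw [Nat.count_eq_card_filter_range, Finset.card_filter]

theorem Nat.count_mul_eq_sum' (P : ℕ → Prop) [DecidablePred P] (a b : ℕ) :
    Nat.count P (a * b) = ∑ s ∈ Finset.range a, Nat.count (fun t => P (a * t + s)) b := by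
  rw [Nat.count_mul_eq_sum]
  simp only [Nat.count_eq_sum_ite]
  exact Finset.sum_comm

theorem Nat.count_congr_lt {P Q : ℕ → Prop} [DecidablePred P] [DecidablePred Q] {a : ℕ}
    (h : ∀ s < a, (P s ↔ Q s)) : Nat.count P a = Nat.count Q a := by
  rw [Nat.count_eq_card_filter_range, Nat.count_eq_card_filter_range]
  congr 1
  ext s
  simp only [Finset.mem_filter, Finset.mem_range]
  exact and_congr_right (h s)

theorem Nat.count_add_two_sub {P Q : ℕ → Prop} [DecidablePred P] [DecidablePred Q] {a : ℕ}
    (h : ∀ s, s + 2 < a → (P s ↔ Q s)) : |(Nat.count P a : ℝ) - Nat.count Q a| ≤ 2 := by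
  have key : ∀ (P : ℕ → Prop) [DecidablePred P], Nat.count P (a - 2) ≤ Nat.count P a ∧
      Nat.count P a ≤ Nat.count P (a - 2) + 2 := by
    intro P _
    refine ⟨Nat.count_monotone P (Nat.sub_le a 2), ?_⟩
    calc Nat.count P a ≤ Nat.count P (a - 2 + 2) := Nat.count_monotone P (by omega)
      _ ≤ _ := by
        rw [Nat.count_add]
        gcongr
        exact Nat.count_le _
  have h1 := key P
  have h2 := key Q
  have h3 : Nat.count P (a - 2) = Nat.count Q (a - 2) :=
    Nat.count_congr_lt fun s hs => h s (by omega)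
  rw [abs_le]
  constructor
  · have : (Nat.count Q a : ℝ) ≤ Nat.count P a + 2 := by exact_mod_cast (by omega)
    linarith
  · have : (Nat.count P a : ℝ) ≤ Nat.count Q a + 2 := by exact_mod_cast (by omega)
    linarith

theorem hasAsympDensity_iff_count {P : ℕ → Prop} [DecidablePred P] {d : ℝ} :
    HasAsympDensity {n | P n} d ↔
      Tendsto (fun N : ℕ => (Nat.count P N : ℝ) / N) atTop (𝓝 d) := by
  have : ∀ N, ({n | P n} ∩ Set.Iio N).ncard = Nat.count P N := by
    intro N
    rw [Nat.count_eq_card_filter_range, ← Set.ncard_coe_finset]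
    congr 1
    ext n
    simp [and_comm]
  simp only [HasAsympDensity, this]

/-- A set has density `d` if, at arbitrarily fine precision, all the consecutive blocks of some
length contain a proportion of elements close to `d`. -/
theorem hasAsympDensity_of_blocks {P : ℕ → Prop} [DecidablePred P] {d : ℝ}
    (h : ∀ ε > 0, ∃ q : ℕ, 0 < q ∧
      ∀ N, |(Nat.count (fun n => P (q * N + n)) q : ℝ) - d * q| ≤ ε * q) :
    HasAsympDensity {n | P n} d := by
  rw [hasAsympDensity_iff_count, Metric.tendsto_atTop]
  intro ε hε
  obtain ⟨q, hq, hb⟩ := h (ε / 2) (by positivity)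
  have hblocks : ∀ N : ℕ, |(Nat.count P (q * N) : ℝ) - d * (q * N)| ≤ ε / 2 * (q * N) := by
    intro N
    induction N with
    | zero => simp
    | succ N ih =>
      rw [mul_add_one, Nat.count_add]
      push_cast
      have h1 := hb N
      rw [abs_le] at *
      constructor <;> linarith
  have hall : ∀ N : ℕ, |(Nat.count P N : ℝ) - d * N| ≤ ε / 2 * N + (1 + |d|) * q := by
    intro N
    have h1 := hblocks (N / q)
    have hN := Nat.div_add_mod N q
    have hr : N % q < q := Nat.mod_lt N hq
    set a := N / q
    set b := N % q
    rw [← hN, Nat.count_add]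
    push_cast
    have hc : (Nat.count (fun k => P (q * a + k)) b : ℝ) ≤ b := by exact_mod_cast Nat.count_le _
    have hc0 : (0 : ℝ) ≤ Nat.count (fun k => P (q * a + k)) b := by positivity
    have hb : (b : ℝ) ≤ q := by exact_mod_cast hr.le
    have hb0 : (0 : ℝ) ≤ b := by positivity
    have hd : |d * b| ≤ |d| * q := by
      rw [abs_mul, abs_of_nonneg hb0]
      gcongr
    have : 0 ≤ ε / 2 * b := by positivity
    rw [abs_le] at *
    constructor <;> linarith
  obtain ⟨N₀, hN₀⟩ := exists_nat_gt ((1 + |d|) * q / (ε / 2))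
  refine ⟨N₀ + 1, fun N hN => ?_⟩
  have hNpos : (0 : ℝ) < N := by exact_mod_cast (by omega : 0 < N)
  have hNN : (N₀ : ℝ) ≤ N := by exact_mod_cast (by omega : N₀ ≤ N)
  rw [Real.dist_eq, show (Nat.count P N : ℝ) / N - d = (Nat.count P N - d * N) / N by field_simp,
    abs_div, abs_of_pos hNpos, div_lt_iff₀ hNpos]
  have := hall N
  rw [div_lt_iff₀ (by positivity)] at hN₀
  nlinarith

/-! ### Two-scale digit splitting, and the case where some T_n vanishes -/

section

variable {p : ℕ} [hp : Fact p.Prime]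

theorem exists_pow_ge (C : ℝ) : ∃ i₀ : ℕ, ∀ i ≥ i₀, C ≤ (p : ℝ) ^ i :=
  (tendsto_pow_atTop_atTop_of_one_lt (by exact_mod_cast hp.out.one_lt)).eventually_ge_atTop C
    |>.exists_forall_of_atTop

theorem motzkin_two_scale (i j N : ℕ) {s t : ℕ} (ht : t < p ^ j) (hs : s + 2 < p ^ i) :
    (motzkin (p ^ i * p ^ j * N + (p ^ i * t + s)) : ZMod p) =
      centralTrinomial N * centralTrinomial t * motzkin s := by
  rw [show p ^ i * p ^ j * N + (p ^ i * t + s) = p ^ i * (p ^ j * N + t) + s by ring,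
    motzkin_lucas (p := p) i _ hs, centralTrinomial_lucas (p := p) j _ ht]

/-- In a block of length p^(i+j), the product formula fails for at most two s per t, an error of 2
p^j. This is negligible once p^i is large, so i must be available beyond any bound while j is free.
-/
theorem valueHasDensity_motzkin_of_two_scale {x : ZMod p} {d : ℝ}
    (h : ∀ ε > 0, ∀ i₀ : ℕ, ∃ i ≥ i₀, ∃ j : ℕ, ∀ N,
      |((∑ t ∈ Finset.range (p ^ j), Nat.count (fun s =>
        (centralTrinomial N * centralTrinomial t * motzkin s : ZMod p) = x) (p ^ i) : ℕ) : ℝ) -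
          d * ((p : ℝ) ^ i * (p : ℝ) ^ j)| ≤ ε * ((p : ℝ) ^ i * (p : ℝ) ^ j)) :
    ValueHasDensity (fun n => (motzkin n : ZMod p)) x d := by
  have hp0 : (0 : ℝ) < p := by exact_mod_cast hp.out.pos
  refine hasAsympDensity_of_blocks fun ε hε => ?_
  obtain ⟨i₀, hi₀⟩ := exists_pow_ge (p := p) (2 / (ε / 2))
  obtain ⟨i, hi, j, hij⟩ := h (ε / 2) (by positivity) i₀
  refine ⟨p ^ i * p ^ j, mul_pos (pow_pos hp.out.pos i) (pow_pos hp.out.pos j), fun N => ?_⟩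
  have h1 := hij N
  have h2 : |(Nat.count (fun n => (motzkin (p ^ i * p ^ j * N + n) : ZMod p) = x)
      (p ^ i * p ^ j) : ℝ) - ((∑ t ∈ Finset.range (p ^ j), Nat.count (fun s =>
        (centralTrinomial N * centralTrinomial t * motzkin s : ZMod p) = x) (p ^ i) : ℕ) : ℝ)| ≤
      2 * (p : ℝ) ^ j := by
    rw [Nat.count_mul_eq_sum]
    push_cast
    rw [← Finset.sum_sub_distrib]
    refine (Finset.abs_sum_le_sum_abs _ _).trans ?_
    refine (Finset.sum_le_card_nsmul _ _ 2 fun t ht => ?_).trans_eq ?_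
    · refine Nat.count_add_two_sub fun s hs => ?_
      rw [motzkin_two_scale i j N (Finset.mem_range.1 ht) hs]
    · rw [Finset.card_range, nsmul_eq_mul, mul_comm]
      push_cast
      rfl
  have h3 : 2 * (p : ℝ) ^ j ≤ ε / 2 * ((p : ℝ) ^ i * (p : ℝ) ^ j) := by
    have := hi₀ i hi
    rw [div_le_iff₀ (by positivity)] at this
    have hj : 0 < (p : ℝ) ^ j := by positivity
    nlinarith
  push_cast
  rw [abs_le] at *
  constructor <;> linarith

/-- By Lucas, T_t ≠ 0 forces every digit of t to avoid m. -/
theorem count_centralTrinomial_ne_zero_le {m : ℕ} (hm : m < p) (h : p ∣ centralTrinomial m)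
    (j : ℕ) : Nat.count (fun t => (centralTrinomial t : ZMod p) ≠ 0) (p ^ j) ≤ (p - 1) ^ j := by
  induction j with
  | zero => simpa using Nat.count_le _
  | succ j ih =>
    rw [pow_succ' p, Nat.count_mul_eq_sum', pow_succ' (p - 1)]
    have hm' : m ∈ Finset.range p := Finset.mem_range.2 hm
    rw [← Finset.add_sum_erase _ _ hm']
    have h0 : Nat.count (fun t => (centralTrinomial (p * t + m) : ZMod p) ≠ 0) (p ^ j) = 0 := by
      rw [Nat.count_congr_lt (Q := fun _ => False)]
      · simp
      · intro s _
        rw [centralTrinomial_mul_add _ hm, (ZMod.natCast_eq_zero_iff _ _).2 h]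
        simp
    rw [h0, zero_add]
    refine (Finset.sum_le_card_nsmul _ _ ((p - 1) ^ j) fun s hs => ?_).trans_eq ?_
    · refine le_trans ?_ ih
      refine Nat.count_mono_left fun t _ ht => ?_
      rw [centralTrinomial_mul_add _ (Finset.mem_range.1 (Finset.mem_of_mem_erase hs))] at ht
      exact left_ne_zero_of_mul ht
    · rw [Finset.card_erase_of_mem hm', Finset.card_range, smul_eq_mul]

theorem Nat.count_add_count_not (P : ℕ → Prop) [DecidablePred P] (n : ℕ) :
    Nat.count P n + Nat.count (fun k => ¬ P k) n = n := by
  rw [Nat.count_eq_card_filter_range, Nat.count_eq_card_filter_range,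
    Finset.card_filter_add_card_filter_not, Finset.card_range]

theorem valueHasDensity_motzkin_zero_one (h : ∃ n < p, p ∣ centralTrinomial n) :
    ValueHasDensity (fun n => (motzkin n : ZMod p)) 0 1 := by
  obtain ⟨m, hm, hdvd⟩ := h
  have hp0 : (0 : ℝ) < p := by exact_mod_cast hp.out.pos
  refine valueHasDensity_motzkin_of_two_scale fun ε hε i₀ => ⟨i₀, le_rfl, ?_⟩
  obtain ⟨j, hj⟩ : ∃ j : ℕ, (((p - 1 : ℕ) : ℝ) / p) ^ j < ε :=
    exists_pow_lt_of_lt_one hε (by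
      rw [div_lt_one hp0]
      exact_mod_cast Nat.sub_lt hp.out.pos one_pos)
  refine ⟨j, fun N => ?_⟩
  rw [div_pow, div_lt_iff₀ (by positivity)] at hj
  set S := ∑ t ∈ Finset.range (p ^ j), Nat.count (fun s =>
        (centralTrinomial N * centralTrinomial t * motzkin s : ZMod p) = 0) (p ^ i₀)
  have hle : S ≤ p ^ i₀ * p ^ j := by
    refine (Finset.sum_le_card_nsmul _ _ (p ^ i₀) fun t _ => Nat.count_le _).trans_eq ?_
    rw [Finset.card_range, smul_eq_mul, mul_comm]
  have hge : p ^ i₀ * Nat.count (fun t => (centralTrinomial t : ZMod p) = 0) (p ^ j) ≤ S := by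
    rw [Nat.count_eq_sum_ite, Finset.mul_sum]
    refine Finset.sum_le_sum fun t _ => ?_
    split_ifs with ht
    · simp [ht]
    · simp
  have hQ := count_centralTrinomial_ne_zero_le hm hdvd j
  have hsum := Nat.count_add_count_not (fun t => (centralTrinomial t : ZMod p) = 0) (p ^ j)
  have hge' : p ^ i₀ * p ^ j ≤ S + p ^ i₀ * (p - 1) ^ j := by
    nth_rewrite 1 [← hsum]
    rw [mul_add]
    gcongr
  have hle' : (S : ℝ) ≤ (p : ℝ) ^ i₀ * (p : ℝ) ^ j := by exact_mod_cast hle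
  have hge'' : (p : ℝ) ^ i₀ * (p : ℝ) ^ j ≤ S + (p : ℝ) ^ i₀ * ((p - 1 : ℕ) : ℝ) ^ j := by
    exact_mod_cast hge'
  have hpi : (0 : ℝ) < (p : ℝ) ^ i₀ := by positivity
  rw [abs_le]
  constructor
  · nlinarith
  · have : 0 < ε * ((p : ℝ) ^ i₀ * (p : ℝ) ^ j) := by positivity
    linarith

end

/-! ### Ratios of consecutive central trinomials and the density of zero -/

section

variable {p : ℕ} [hp : Fact p.Prime]

/-- The number of `n < N` for which the ratio `T_{n+1} / T_n` equals `c`, over `ZMod p`. -/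
def ratioCount (p : ℕ) (c : ZMod p) (N : ℕ) : ℕ :=
  Nat.count (fun n => (centralTrinomial (n + 1) : ZMod p) = c * centralTrinomial n) N

theorem Nat.count_const (Q : Prop) [Decidable Q] (n : ℕ) :
    Nat.count (fun _ => Q) n = n * if Q then 1 else 0 := by
  by_cases h : Q <;> simp [h]

/-- Write n = p t + s. For s < p-1 there is no carry and the factor T_t cancels. For s = p-1 the
ratio is T_(t+1) / (e T_t) with e = T_(p-1), and e^2 = 1 is not yet needed. -/
theorem ratioCount_pow_succ (hT : ∀ n < p, ¬ p ∣ centralTrinomial n) (c : ZMod p) (i : ℕ) :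
    ratioCount p c (p ^ (i + 1)) = p ^ i * ratioCount p c (p - 1) +
      ratioCount p (centralTrinomial (p - 1) * c) (p ^ i) := by
  have h1 := hp.out.one_lt
  rw [ratioCount, pow_succ', Nat.count_mul_eq_sum']
  have hr : Finset.range p = Finset.range (p - 1 + 1) := by rw [Nat.sub_add_cancel h1.le]
  rw [hr, Finset.sum_range_succ]
  congr 1
  · rw [ratioCount, Nat.count_eq_sum_ite, Finset.mul_sum]
    refine Finset.sum_congr rfl fun s hs => ?_
    rw [Finset.mem_range] at hs
    rw [← Nat.count_const]
    refine Nat.count_congr_lt fun t _ => ?_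
    rw [add_assoc, centralTrinomial_mul_add _ (by omega : s + 1 < p),
      centralTrinomial_mul_add _ (by omega : s < p), mul_left_comm]
    exact mul_right_inj' (centralTrinomial_ne_zero hT t)
  · refine Nat.count_congr_lt fun t _ => ?_
    rw [add_assoc, Nat.sub_add_cancel h1.le, ← mul_add_one, centralTrinomial_mul_prime,
      centralTrinomial_mul_add _ (by omega : p - 1 < p)]
    ring_nf

/-- The density of the set of `n` with `T_{n+1} / T_n = c`. -/
noncomputable def ratioDensity (p : ℕ) (c : ZMod p) : ℝ :=
  (p * ratioCount p c (p - 1) + ratioCount p (centralTrinomial (p - 1) * c) (p - 1)) /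
    ((p : ℝ) ^ 2 - 1)

theorem abs_ratioCount_sub_le (hT : ∀ n < p, ¬ p ∣ centralTrinomial n) (c : ZMod p) (i : ℕ) :
    |(ratioCount p c (p ^ i) : ℝ) - ratioDensity p c * (p : ℝ) ^ i| ≤ 1 := by
  have h1 : (1 : ℝ) < p := by exact_mod_cast hp.out.one_lt
  have hpos : (0 : ℝ) < (p : ℝ) ^ 2 - 1 := by nlinarith
  induction i generalizing c with
  | zero =>
    have hA : ∀ c, (ratioCount p c (p - 1) : ℝ) ≤ p - 1 := by
      intro c
      rw [← Nat.cast_pred hp.out.pos]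
      exact_mod_cast Nat.count_le _
    have hw0 : 0 ≤ ratioDensity p c := by
      rw [ratioDensity]
      positivity
    have hw1 : ratioDensity p c ≤ 1 := by
      rw [ratioDensity, div_le_one hpos]
      have := hA c
      have := hA (centralTrinomial (p - 1) * c)
      nlinarith
    have hW : (ratioCount p c (p ^ 0) : ℝ) ≤ 1 := by
      exact_mod_cast (Nat.count_le _).trans_eq (pow_zero p)
    have hW0 : (0 : ℝ) ≤ ratioCount p c (p ^ 0) := by positivity
    rw [pow_zero (p : ℝ), mul_one, abs_le]
    constructor <;> linarith
  | succ i ih =>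
    have he := centralTrinomial_sub_one_mul_self (ne_three_of_not_dvd_centralTrinomial hT)
    -- The density is the fixed point of the recursion, since e^2 = 1 makes c ↦ e c an involution.
    -- So the error at level i+1 for c equals the error at level i for e c, and never grows.
    have hw : ratioDensity p c * p = ratioCount p c (p - 1) +
        ratioDensity p (centralTrinomial (p - 1) * c) := by
      rw [ratioDensity, ratioDensity, ← mul_assoc, he, one_mul]
      field_simp
      ring
    have := ih (centralTrinomial (p - 1) * c)
    rw [ratioCount_pow_succ hT]
    push_cast
    rw [pow_succ', ← mul_assoc, hw]
    convert this using 2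
    ring

/-- The substitution m ↦ p-2-m turns a ratio c into -3/c by reflection, and 1/c = c here. -/
theorem ratioCount_neg_three_mul (hT : ∀ n < p, ¬ p ∣ centralTrinomial n) {c : ZMod p}
    (hc : c * c = 1) : ratioCount p (-3 * c) (p - 1) = ratioCount p c (p - 1) := by
  have h1 := hp.out.one_lt
  have h3 := neg_three_ne_zero (ne_three_of_not_dvd_centralTrinomial hT)
  have he := centralTrinomial_ne_zero hT (p - 1)
  rw [ratioCount, ratioCount, Nat.count_eq_sum_ite, Nat.count_eq_sum_ite,
    ← Finset.sum_range_reflect]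
  refine Finset.sum_congr rfl fun m hm => ?_
  rw [Finset.mem_range] at hm
  obtain ⟨a, ha⟩ : ∃ a, a + m + 2 = p := ⟨p - 2 - m, by omega⟩
  rw [show p - 1 - 1 - m = a by omega]
  have e1 := centralTrinomial_reflection (p := p) (a := a) (n := m + 1) (by omega)
  have e2 := centralTrinomial_reflection (p := p) (a := a + 1) (n := m) (by omega)
  congr 1
  rw [eq_iff_iff]
  constructor
  · intro h
    apply mul_left_cancel₀ he
    linear_combination -e1 + c * e2 - c * (-3) ^ m * h - hc * (-3) ^ (m + 1) * centralTrinomial a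
  · intro h
    apply mul_left_cancel₀ (pow_ne_zero m h3)
    linear_combination e2 - c * e1 - c * centralTrinomial (p - 1) * h -
      hc * centralTrinomial (p - 1) * centralTrinomial m

theorem count_motzkin_pow_succ (h2 : 2 < p) (hT : ∀ n < p, ¬ p ∣ centralTrinomial n) (i : ℕ) :
    Nat.count (fun n => (motzkin n : ZMod p) = 0) (p ^ (i + 1)) =
      p ^ i * Nat.count (fun n => (motzkin n : ZMod p) = 0) (p - 2) +
        ratioCount p (centralTrinomial (p - 1)) (p ^ i) +
        ratioCount p (-3 * centralTrinomial (p - 1)) (p ^ i) := by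
  have htwo : (2 : ZMod p) ≠ 0 := by
    intro h
    have : ((2 : ℕ) : ZMod p) = 0 := by exact_mod_cast h
    rw [ZMod.natCast_eq_zero_iff] at this
    exact absurd (Nat.le_of_dvd (by norm_num) this) (by omega)
  rw [pow_succ', Nat.count_mul_eq_sum']
  have hr : Finset.range p = Finset.range (p - 2 + 1 + 1) := by congr 1; omega
  rw [hr, Finset.sum_range_succ, Finset.sum_range_succ]
  congr 1
  congr 1
  · rw [Nat.count_eq_sum_ite, Finset.mul_sum]
    refine Finset.sum_congr rfl fun s hs => ?_
    rw [Finset.mem_range] at hs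
    rw [← Nat.count_const]
    refine Nat.count_congr_lt fun t _ => ?_
    rw [motzkin_mul_add _ (by omega), mul_eq_zero, or_iff_right (centralTrinomial_ne_zero hT t)]
  · refine Nat.count_congr_lt fun t _ => ?_
    rw [← mul_right_inj' htwo, two_mul_motzkin_mul_add_sub_two t (by omega), mul_zero, sub_eq_zero,
      eq_comm]
  · refine Nat.count_congr_lt fun t _ => ?_
    rw [← mul_right_inj' htwo, show p - 2 + 1 = p - 1 by omega, two_mul_motzkin_mul_add_sub_one t,
      mul_zero, add_eq_zero_iff_neg_eq, eq_comm, ← neg_mul, ← neg_mul]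

theorem motzkinZeroDensity_eq (hT : ∀ n < p, ¬ p ∣ centralTrinomial n) :
    motzkinZeroDensity p * p = Nat.count (fun n => (motzkin n : ZMod p) = 0) (p - 2) +
      ratioDensity p (centralTrinomial (p - 1)) +
        ratioDensity p (-3 * centralTrinomial (p - 1)) := by
  have he := centralTrinomial_sub_one_mul_self (ne_three_of_not_dvd_centralTrinomial hT)
  have h1 : (1 : ℝ) < p := by exact_mod_cast hp.out.one_lt
  have hpos : (0 : ℝ) < (p : ℝ) ^ 2 - 1 := by nlinarith
  have hpos' : (0 : ℝ) < (p : ℝ) - 1 := by linarith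
  have hA : ratioCount p (centralTrinomial (p - 1)) (p - 1) =
      (({m ∈ Finset.range (p - 1) | (centralTrinomial m : ZMod p)
        = (centralTrinomial (p - 1) : ZMod p) * (centralTrinomial (m + 1) : ZMod p)} :
          Finset ℕ).card) := by
    rw [ratioCount, Nat.count_eq_card_filter_range]
    congr 1
    refine Finset.filter_congr fun m _ => ⟨fun h => ?_, fun h => ?_⟩
    · rw [h, ← mul_assoc, he, one_mul]
    · rw [h, ← mul_assoc, he, one_mul]
  have hB : ratioCount p 1 (p - 1) =
      (({m ∈ Finset.range (p - 1) | (centralTrinomial m : ZMod p)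
        = (centralTrinomial (m + 1) : ZMod p)} : Finset ℕ).card) := by
    rw [ratioCount, Nat.count_eq_card_filter_range]
    simp only [one_mul, eq_comm]
  have h3 := ratioCount_neg_three_mul hT he
  have h3' := ratioCount_neg_three_mul hT (c := 1) (one_mul 1)
  rw [motzkinZeroDensity, ← hA, ← hB, ← Nat.count_eq_card_filter_range, ratioDensity, ratioDensity,
    mul_left_comm _ (-3 : ZMod p), he, h3, h3', show (p : ℝ) ^ 2 - 1 = (p - 1) * (p + 1) by ring]
  field_simp
  ring

theorem abs_count_motzkin_sub_le (h2 : 2 < p) (hT : ∀ n < p, ¬ p ∣ centralTrinomial n) (i : ℕ) :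
    |(Nat.count (fun n => (motzkin n : ZMod p) = 0) (p ^ (i + 1)) : ℝ) -
      motzkinZeroDensity p * (p : ℝ) ^ (i + 1)| ≤ 2 := by
  rw [count_motzkin_pow_succ h2 hT, pow_succ', ← mul_assoc, motzkinZeroDensity_eq hT]
  push_cast
  have h := abs_ratioCount_sub_le hT (centralTrinomial (p - 1)) i
  have h' := abs_ratioCount_sub_le hT (-3 * centralTrinomial (p - 1)) i
  rw [abs_le] at *
  constructor <;> linarith

theorem valueHasDensity_motzkin_zero (h2 : 2 < p) (hT : ∀ n < p, ¬ p ∣ centralTrinomial n) :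
    ValueHasDensity (fun n => (motzkin n : ZMod p)) 0 (motzkinZeroDensity p) := by
  refine valueHasDensity_motzkin_of_two_scale fun ε hε i₀ => ?_
  obtain ⟨i₁, hi₁⟩ := exists_pow_ge (p := p) (2 / ε)
  -- No middle digits are needed: T_N is a unit, so it does not affect vanishing.
  refine ⟨max i₀ i₁ + 1, by omega, 0, fun N => ?_⟩
  have h := abs_count_motzkin_sub_le h2 hT (max i₀ i₁)
  have h3 := hi₁ (max i₀ i₁ + 1) (by omega)
  rw [div_le_iff₀ hε] at h3
  rw [pow_zero, Finset.sum_range_one, pow_zero, mul_one, centralTrinomial_zero]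
  simp only [Nat.cast_one, mul_one, mul_eq_zero, centralTrinomial_ne_zero hT N, false_or]
  linarith

/-- Both T-counts are at least 1, and the value with both equal to 1 and no M-zeros is exactly the
bound. The witness is m = 0, except that the first count takes m = p-3 when T_(p-1) = -1. -/
theorem motzkinZeroDensity_ge (h2 : 2 < p) (hT : ∀ n < p, ¬ p ∣ centralTrinomial n) :
    2 / ((p : ℝ) * ((p : ℝ) - 1)) ≤ motzkinZeroDensity p := by
  have h3 := ne_three_of_not_dvd_centralTrinomial hT
  have h1 : (1 : ℝ) < p := by exact_mod_cast hp.out.one_lt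
  have hpos' : (0 : ℝ) < (p : ℝ) - 1 := by linarith
  have hA : 1 ≤ (({m ∈ Finset.range (p - 1) | (centralTrinomial m : ZMod p)
        = (centralTrinomial (p - 1) : ZMod p) * (centralTrinomial (m + 1) : ZMod p)} :
          Finset ℕ).card) := by
    rw [Nat.one_le_iff_ne_zero, ← Nat.pos_iff_ne_zero, Finset.card_pos]
    rcases mul_self_eq_one_iff.1 (centralTrinomial_sub_one_mul_self h3) with he | he
    · refine ⟨0, Finset.mem_filter.2 ⟨Finset.mem_range.2 (by omega), ?_⟩⟩
      rw [he, centralTrinomial_zero, zero_add, centralTrinomial_one, one_mul]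
    · obtain ⟨a, ha⟩ : ∃ a, a + 3 = p := ⟨p - 3, by omega⟩
      refine ⟨a, Finset.mem_filter.2 ⟨Finset.mem_range.2 (by omega), ?_⟩⟩
      have e1 := centralTrinomial_reflection (p := p) (a := a) (n := 2) (by omega)
      have e2 := centralTrinomial_reflection (p := p) (a := a + 1) (n := 1) (by omega)
      rw [centralTrinomial_two] at e1
      rw [centralTrinomial_one] at e2
      push_cast at e1 e2
      have hn := neg_three_ne_zero h3
      rw [he] at *
      apply mul_left_cancel₀ (pow_ne_zero 2 hn)
      linear_combination e1 - 3 * e2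
  have hB : 1 ≤ (({m ∈ Finset.range (p - 1) | (centralTrinomial m : ZMod p)
        = (centralTrinomial (m + 1) : ZMod p)} : Finset ℕ).card) := by
    rw [Nat.one_le_iff_ne_zero, ← Nat.pos_iff_ne_zero, Finset.card_pos]
    refine ⟨0, Finset.mem_filter.2 ⟨Finset.mem_range.2 (by omega), ?_⟩⟩
    rw [centralTrinomial_zero, zero_add, centralTrinomial_one]
  have key : 2 / ((p : ℝ) * ((p : ℝ) - 1)) = 0 / p + 2 * 1 / (((p : ℝ) - 1) * ((p : ℝ) + 1)) +
      2 * 1 / (((p : ℝ) - 1) * (p : ℝ) * ((p : ℝ) + 1)) := by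
    field_simp
    ring
  rw [key, motzkinZeroDensity]
  gcongr
  · positivity
  · exact_mod_cast hA
  · exact_mod_cast hB

end

/-! ### Character sums and the density of nonzero values -/

section

variable {p : ℕ} [hp : Fact p.Prime]

theorem sum_character_centralTrinomial (χ : DirichletCharacter ℂ p) (j : ℕ) :
    ∑ t ∈ Finset.range (p ^ j), χ (centralTrinomial t) =
      (∑ m ∈ Finset.range p, χ (centralTrinomial m)) ^ j := by
  induction j with
  | zero => simp [centralTrinomial_zero]
  | succ j ih =>
    have key : ∀ b, ∑ t ∈ Finset.range (p * b), χ (centralTrinomial t) =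
        ∑ t ∈ Finset.range b, ∑ m ∈ Finset.range p, χ (centralTrinomial (p * t + m)) := by
      intro b
      induction b with
      | zero => simp
      | succ b ihb => rw [mul_add_one, Finset.sum_range_add, ihb, Finset.sum_range_succ]
    rw [pow_succ', key, pow_succ, ← ih, Finset.sum_mul_sum]
    refine Finset.sum_congr rfl fun t _ => Finset.sum_congr rfl fun m hm => ?_
    rw [centralTrinomial_mul_add _ (Finset.mem_range.1 hm), map_mul]

theorem eq_one_of_forall_centralTrinomial (hT : ∀ n < p, ¬ p ∣ centralTrinomial n)
    (hconj : TrinomialGenerationConjectureAt p) {χ : DirichletCharacter ℂ p}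
    (h : ∀ m < p, χ (centralTrinomial m) = 1) : χ = 1 := by
  have hle : Subgroup.closure {g : (ZMod p)ˣ | ∃ n < p, (g : ZMod p) = (centralTrinomial n : ZMod p)}
      ≤ (MulChar.toUnitHom χ).ker := by
    rw [Subgroup.closure_le]
    rintro g ⟨n, hn, hg⟩
    rw [SetLike.mem_coe, MonoidHom.mem_ker, Units.ext_iff, MulChar.coe_toUnitHom, hg, h n hn,
      Units.val_one]
  rw [hconj hT, top_le_iff] at hle
  ext g
  have : g ∈ (MulChar.toUnitHom χ).ker := hle ▸ Subgroup.mem_top g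
  rw [MonoidHom.mem_ker, Units.ext_iff, MulChar.coe_toUnitHom] at this
  rw [this, MulChar.one_apply_coe, Units.val_one]

theorem norm_one_add_lt_two {z : ℂ} (hz : ‖z‖ = 1) (h : z ≠ 1) : ‖1 + z‖ < 2 := by
  have hns : z.re * z.re + z.im * z.im = 1 := by
    rw [← Complex.normSq_apply, Complex.normSq_eq_norm_sq, hz, one_pow]
  have hre : z.re < 1 := by
    refine lt_of_le_of_ne (by nlinarith [mul_self_nonneg z.im]) fun h1 => h ?_
    refine Complex.ext h1 ?_
    rw [h1] at hns
    have : z.im * z.im = 0 := by linarith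
    simpa using this
  refine lt_of_pow_lt_pow_left₀ 2 (by norm_num) ?_
  rw [← Complex.normSq_eq_norm_sq, Complex.normSq_apply]
  simp only [Complex.add_re, Complex.one_re, Complex.add_im, Complex.one_im]
  nlinarith

/-- All p terms lie on the unit circle; T_0 contributes 1 and, by the conjecture, some term differs
from 1, so the triangle inequality is strict. -/
theorem norm_sum_character_lt (hT : ∀ n < p, ¬ p ∣ centralTrinomial n)
    (hconj : TrinomialGenerationConjectureAt p) {χ : DirichletCharacter ℂ p} (hχ : χ ≠ 1) :
    ‖∑ m ∈ Finset.range p, χ (centralTrinomial m)‖ < p := by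
  have hnorm : ∀ m, ‖χ (centralTrinomial m)‖ = 1 := fun m =>
    χ.unit_norm_eq_one (centralTrinomial_ne_zero hT m).isUnit.unit
  obtain ⟨m, hm, hne⟩ : ∃ m < p, χ (centralTrinomial m) ≠ 1 := by
    by_contra! hcon
    exact hχ (eq_one_of_forall_centralTrinomial hT hconj hcon)
  have hm0 : m ≠ 0 := by
    rintro rfl
    simp [centralTrinomial_zero] at hne
  have h0 : 0 ∈ Finset.range p := Finset.mem_range.2 hp.out.pos
  have hm' : m ∈ (Finset.range p).erase 0 := Finset.mem_erase.2 ⟨hm0, Finset.mem_range.2 hm⟩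
  rw [← Finset.add_sum_erase _ _ h0, ← Finset.add_sum_erase _ _ hm', ← add_assoc,
    centralTrinomial_zero, Nat.cast_one, map_one]
  have h1 := norm_one_add_lt_two (hnorm m) hne
  have h2 : ‖∑ k ∈ ((Finset.range p).erase 0).erase m, χ (centralTrinomial k)‖ ≤ p - 2 := by
    refine (norm_sum_le _ _).trans_eq ?_
    simp only [hnorm, Finset.sum_const, nsmul_eq_mul, mul_one]
    rw [Finset.card_erase_of_mem hm', Finset.card_erase_of_mem h0, Finset.card_range, Nat.sub_sub,
      Nat.cast_sub hp.out.two_le]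
    norm_num
  calc _ ≤ _ := norm_add_le _ _
    _ < p := by linarith

/-- Orthogonality of characters: after division by p^j only the trivial character survives in the
limit. -/
theorem tendsto_count_centralTrinomial (hT : ∀ n < p, ¬ p ∣ centralTrinomial n)
    (hconj : TrinomialGenerationConjectureAt p) {y : ZMod p} (hy : y ≠ 0) :
    Tendsto (fun j : ℕ => (Nat.count (fun t => (centralTrinomial t : ZMod p) = y) (p ^ j) : ℝ) /
      (p : ℝ) ^ j) atTop (𝓝 (1 / ((p : ℝ) - 1))) := by
  have h1 : (1 : ℝ) < p := by exact_mod_cast hp.out.one_lt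
  have hpc : (p : ℂ) ≠ 0 := by exact_mod_cast hp.out.ne_zero
  have hcount : ∀ j : ℕ, (((p : ℝ) - 1 : ℝ) : ℂ) *
      (Nat.count (fun t => (centralTrinomial t : ZMod p) = y) (p ^ j) : ℂ) =
      ∑ χ : DirichletCharacter ℂ p, χ y⁻¹ * (∑ m ∈ Finset.range p, χ (centralTrinomial m)) ^ j := by
    intro j
    simp only [← sum_character_centralTrinomial, Finset.mul_sum]
    rw [Finset.sum_comm]
    simp only [DirichletCharacter.sum_char_inv_mul_char_eq ℂ hy.isUnit, Nat.totient_prime hp.out]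
    rw [Nat.count_eq_sum_ite, Nat.cast_sum, Finset.mul_sum]
    refine Finset.sum_congr rfl fun t _ => ?_
    rw [Nat.cast_pred hp.out.pos]
    by_cases h : (centralTrinomial t : ZMod p) = y
    · simp [h]
    · simp [h, Ne.symm h]
  have hlim : Tendsto (fun j : ℕ => ∑ χ : DirichletCharacter ℂ p,
      χ y⁻¹ * ((∑ m ∈ Finset.range p, χ (centralTrinomial m)) / p) ^ j) atTop
      (𝓝 (∑ χ : DirichletCharacter ℂ p, if χ = 1 then 1 else 0)) := by
    refine tendsto_finsetSum _ fun χ _ => ?_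
    split_ifs with hχ
    · subst hχ
      have h2 : ∑ m ∈ Finset.range p, (1 : DirichletCharacter ℂ p) (centralTrinomial m) = p := by
        simp [MulChar.one_apply (centralTrinomial_ne_zero hT _).isUnit]
      rw [h2, div_self hpc, MulChar.one_apply (inv_ne_zero hy).isUnit]
      simp
    · rw [← mul_zero (χ y⁻¹)]
      refine (tendsto_pow_atTop_nhds_zero_of_norm_lt_one ?_).const_mul _
      rw [norm_div, Complex.norm_natCast, div_lt_one (by linarith)]
      exact norm_sum_character_lt hT hconj hχ
  rw [Finset.sum_ite_eq' Finset.univ (1 : DirichletCharacter ℂ p), if_pos (Finset.mem_univ _)]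
    at hlim
  have hlim' : Tendsto (fun j : ℕ => ((p : ℝ) - 1) *
      ((Nat.count (fun t => (centralTrinomial t : ZMod p) = y) (p ^ j) : ℝ) / (p : ℝ) ^ j))
      atTop (𝓝 1) := by
    rw [Complex.isometry_ofReal.isEmbedding.tendsto_nhds_iff, Complex.ofReal_one]
    refine Tendsto.congr (fun j => ?_) hlim
    have := hcount j
    simp only [div_pow, ← mul_div_assoc, ← Finset.sum_div]
    rw [← this, Function.comp_apply]
    push_cast
    rfl
  refine (hlim'.div_const ((p : ℝ) - 1)).congr fun j => ?_
  field_simp [(by linarith : (p : ℝ) - 1 ≠ 0)]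

/-- Summing over s first: each s with M_s ≠ 0 prescribes one unit value for T_t, taken by about p^j
/ (p-1) of the t, and there are about (1 - D₀) p^i such s. The bound is uniform in N because the
equidistribution is uniform over the finitely many units. -/
theorem valueHasDensity_motzkin_of_ne_zero (hT : ∀ n < p, ¬ p ∣ centralTrinomial n)
    (hconj : TrinomialGenerationConjectureAt p) {D₀ : ℝ}
    (hD : ValueHasDensity (fun n => (motzkin n : ZMod p)) 0 D₀) {x : ZMod p} (hx : x ≠ 0) :
    ValueHasDensity (fun n => (motzkin n : ZMod p)) x ((1 - D₀) / ((p : ℝ) - 1)) := by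
  have h1 : (1 : ℝ) < p := by exact_mod_cast hp.out.one_lt
  have h2 : (2 : ℝ) ≤ p := by exact_mod_cast hp.out.two_le
  refine valueHasDensity_motzkin_of_two_scale fun ε hε i₀ => ?_
  have hZ : Tendsto (fun i : ℕ => (Nat.count (fun n => (motzkin n : ZMod p) = 0) (p ^ i) : ℝ) /
      ((p ^ i : ℕ) : ℝ)) atTop (𝓝 D₀) :=
    (hasAsympDensity_iff_count.1 hD).comp (tendsto_pow_atTop_atTop_of_one_lt hp.out.one_lt)
  obtain ⟨i, hiZ, hi⟩ := ((Metric.tendsto_nhds.1 hZ (ε / 2) (by positivity)).and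
    (eventually_ge_atTop i₀)).exists
  have hV : ∀ᶠ j : ℕ in atTop, ∀ y : ZMod p, y ≠ 0 →
      dist ((Nat.count (fun t => (centralTrinomial t : ZMod p) = y) (p ^ j) : ℝ) / (p : ℝ) ^ j)
        (1 / ((p : ℝ) - 1)) < ε / 2 := by
    rw [eventually_all]
    intro y
    by_cases hy : y = 0
    · simp [hy]
    · filter_upwards [Metric.tendsto_nhds.1 (tendsto_count_centralTrinomial hT hconj hy) (ε / 2)
        (by positivity)] with j hj _ using hj
  obtain ⟨j, hj⟩ := hV.exists
  refine ⟨i, hi, j, fun N => ?_⟩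
  have hpi : (0 : ℝ) < (p : ℝ) ^ i := by positivity
  have hpj : (0 : ℝ) < (p : ℝ) ^ j := by positivity
  have hswap : ∑ t ∈ Finset.range (p ^ j), Nat.count (fun s =>
      (centralTrinomial N * centralTrinomial t * motzkin s : ZMod p) = x) (p ^ i) =
      ∑ s ∈ Finset.range (p ^ i), Nat.count (fun t =>
        (centralTrinomial N * centralTrinomial t * motzkin s : ZMod p) = x) (p ^ j) := by
    simp only [Nat.count_eq_sum_ite]
    exact Finset.sum_comm
  have hterm : ∀ s : ℕ, |(Nat.count (fun t =>
      (centralTrinomial N * centralTrinomial t * motzkin s : ZMod p) = x) (p ^ j) : ℝ) -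
        (if (motzkin s : ZMod p) = 0 then 0 else 1) * ((p : ℝ) ^ j / ((p : ℝ) - 1))| ≤
      ε / 2 * (p : ℝ) ^ j := by
    intro s
    split_ifs with hs
    · simp only [hs, mul_zero, hx.symm, Nat.count_false]
      simp
      positivity
    · have hN := centralTrinomial_ne_zero hT N
      have hy : x / (centralTrinomial N * motzkin s) ≠ 0 := div_ne_zero hx (mul_ne_zero hN hs)
      have h3 := hj _ hy
      rw [Nat.count_congr_lt (Q := fun t => (centralTrinomial t : ZMod p) =
        x / (centralTrinomial N * motzkin s)) fun t _ => by
          rw [eq_div_iff (mul_ne_zero hN hs)]; ring_nf]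
      rw [Real.dist_eq] at h3
      have h4 := mul_le_mul_of_nonneg_right h3.le hpj.le
      nth_rewrite 2 [← abs_of_pos hpj] at h4
      rw [← abs_mul, sub_mul, div_mul_cancel₀ _ hpj.ne'] at h4
      rw [one_div_mul_eq_div] at h4
      rwa [one_mul]
  have hsum : |((∑ s ∈ Finset.range (p ^ i), Nat.count (fun t =>
        (centralTrinomial N * centralTrinomial t * motzkin s : ZMod p) = x) (p ^ j) : ℕ) : ℝ) -
      ((p : ℝ) ^ i - Nat.count (fun n => (motzkin n : ZMod p) = 0) (p ^ i)) *
        ((p : ℝ) ^ j / ((p : ℝ) - 1))| ≤ (p : ℝ) ^ i * (ε / 2 * (p : ℝ) ^ j) := by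
    have hc : (p : ℝ) ^ i - Nat.count (fun n => (motzkin n : ZMod p) = 0) (p ^ i) =
        ∑ s ∈ Finset.range (p ^ i), if (motzkin s : ZMod p) = 0 then (0 : ℝ) else 1 := by
      have h3 := Nat.count_add_count_not (fun n => (motzkin n : ZMod p) = 0) (p ^ i)
      have h4 : (Nat.count (fun n => (motzkin n : ZMod p) = 0) (p ^ i) : ℝ) +
          Nat.count (fun n => ¬ (motzkin n : ZMod p) = 0) (p ^ i) = (p : ℝ) ^ i := by
        exact_mod_cast h3
      rw [← h4, add_sub_cancel_left, Nat.count_eq_sum_ite]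
      push_cast
      exact Finset.sum_congr rfl fun s _ => by simp [ite_not]
    rw [hc, Finset.sum_mul, Nat.cast_sum, ← Finset.sum_sub_distrib]
    refine (Finset.abs_sum_le_sum_abs _ _).trans ?_
    refine (Finset.sum_le_card_nsmul _ _ _ fun s _ => hterm s).trans_eq ?_
    rw [Finset.card_range, nsmul_eq_mul]
    push_cast
    rfl
  rw [hswap]
  set Z : ℝ := ((Nat.count (fun n => (motzkin n : ZMod p) = 0) (p ^ i) : ℕ) : ℝ)
  have hZ' : |D₀ * (p : ℝ) ^ i - Z| ≤ ε / 2 * (p : ℝ) ^ i := by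
    rw [dist_comm, Real.dist_eq, Nat.cast_pow] at hiZ
    have h4 := mul_le_mul_of_nonneg_right hiZ.le hpi.le
    nth_rewrite 2 [← abs_of_pos hpi] at h4
    rwa [← abs_mul, sub_mul, div_mul_cancel₀ _ hpi.ne'] at h4
  have hlast : |((p : ℝ) ^ i - Z) * ((p : ℝ) ^ j / ((p : ℝ) - 1)) -
      (1 - D₀) / ((p : ℝ) - 1) * ((p : ℝ) ^ i * (p : ℝ) ^ j)| ≤
      ε / 2 * (p : ℝ) ^ i * (p : ℝ) ^ j := by
    have hfac : ((p : ℝ) ^ i - Z) * ((p : ℝ) ^ j / ((p : ℝ) - 1)) -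
        (1 - D₀) / ((p : ℝ) - 1) * ((p : ℝ) ^ i * (p : ℝ) ^ j) =
        (D₀ * (p : ℝ) ^ i - Z) * ((p : ℝ) ^ j / ((p : ℝ) - 1)) := by ring
    rw [hfac, abs_mul, abs_of_nonneg (div_nonneg hpj.le (by linarith))]
    gcongr
    exact div_le_self hpj.le (by linarith)
  calc _ ≤ _ := abs_sub_le _ _ _
    _ ≤ _ := add_le_add hsum hlast
    _ = _ := by ring

theorem valueHasDensity_motzkin_zero_of_ne_zero
    (h : ValueHasDensity (fun n => (motzkin n : ZMod p)) 0 1) {x : ZMod p} (hx : x ≠ 0) :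
    ValueHasDensity (fun n => (motzkin n : ZMod p)) x 0 := by
  have h0 := hasAsympDensity_iff_count.1 h
  refine hasAsympDensity_iff_count.2 ?_
  have h1 := (tendsto_const_nhds (x := (1 : ℝ))).sub h0
  rw [sub_self] at h1
  refine squeeze_zero' (Eventually.of_forall fun N => by positivity) ?_ h1
  filter_upwards [eventually_gt_atTop 0] with N hN
  have hN' : (0 : ℝ) < N := by exact_mod_cast hN
  have hle := Nat.count_mono_left (p := fun n => (motzkin n : ZMod p) = x)
    (q := fun n => ¬ (motzkin n : ZMod p) = 0) (n := N) fun k _ hk h0 => hx (hk ▸ h0)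
  have hs := Nat.count_add_count_not (fun n => (motzkin n : ZMod p) = 0) N
  rw [div_le_iff₀ hN', sub_mul, div_mul_cancel₀ _ hN'.ne', one_mul, le_sub_iff_add_le]
  exact_mod_cast (by omega)

end

/-! ### Assembly: uniqueness of limits identifies D₀ where the density is known -/

theorem mainTheorem2 (p : ℕ) (hp : p.Prime) :
    ((∃ n < p, p ∣ centralTrinomial n) →
      ValueHasDensity (fun n => (motzkin n : ZMod p)) 0 1) ∧
    (2 < p → (∀ n < p, ¬ p ∣ centralTrinomial n) →
      ValueHasDensity (fun n => (motzkin n : ZMod p)) 0 (motzkinZeroDensity p)) ∧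
    (∀ D₀ : ℝ, ValueHasDensity (fun n => (motzkin n : ZMod p)) 0 D₀ →
      (TrinomialGenerationConjectureAt p → ∀ x : ZMod p, x ≠ 0 →
        ValueHasDensity (fun n => (motzkin n : ZMod p)) x ((1 - D₀) / ((p : ℝ) - 1))) ∧
      (2 < p → 2 / ((p : ℝ) * ((p : ℝ) - 1)) ≤ D₀)) := by
  have : Fact p.Prime := ⟨hp⟩
  refine ⟨valueHasDensity_motzkin_zero_one, valueHasDensity_motzkin_zero, fun D₀ hD => ?_⟩
  by_cases hT : ∀ n < p, ¬ p ∣ centralTrinomial n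
  · refine ⟨fun hconj x hx => valueHasDensity_motzkin_of_ne_zero hT hconj hD hx, fun h2 => ?_⟩
    rw [tendsto_nhds_unique hD (valueHasDensity_motzkin_zero h2 hT)]
    exact motzkinZeroDensity_ge h2 hT
  · push Not at hT
    have h1 := valueHasDensity_motzkin_zero_one hT
    obtain rfl : D₀ = 1 := tendsto_nhds_unique hD h1
    refine ⟨fun _ x hx => ?_, fun h2 => ?_⟩
    · rw [sub_self, zero_div]
      exact valueHasDensity_motzkin_zero_of_ne_zero h1 hx
    · have h3 : (3 : ℝ) ≤ p := by exact_mod_cast h2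
      rw [div_le_one (by nlinarith)]
      nlinarith
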